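/- Let formulas be built from a denumerable set of variables with the connectives $\land,\lor,\to$ (binary) and $\sim$ (unary), and let $\alpha\leftrightarrow\beta := (\alpha\to\beta)\land(\beta\to\alpha)$. Let $\mathbf{L}_{\mathrm{QN4}}$ be the Hilbert calculus whose only rule is modus ponens ($\alpha,\ \alpha\to\beta\vdash\beta$) and whose axiom schemes are: 1. $\alpha\to(\beta\to\alpha)$ 2. $(\alpha\to(\beta\to\gamma))\to((\alpha\to\beta)\to(\alpha\to\gamma))$ 3. $(\alpha\land\beta)\to\alpha$ 4. $(\alpha\land\beta)\to\beta$ 5. $(\alpha\to\beta)\to((\alpha\to\gamma)\to(\alpha\to(\beta\land\gamma)))$ 6. $\alpha\to(\alpha\lor\beta)$ 7. $\beta\to(\alpha\lor\beta)$ 8. $(\alpha\to\gamma)\to((\beta\to\gamma)\to((\alpha\lor\beta)\to\gamma))$ 9. ${\sim}(\alpha\lor\beta)\leftrightarrow({\sim}\alpha\land{\sim}\beta)$ 10. ${\sim}(\alpha\to\beta)\leftrightarrow{\sim}{\sim}(\alpha\land{\sim}\beta)$ 11. ${\sim}(\alpha\land(\beta\land\gamma))\leftrightarrow{\sim}((\alpha\land\beta)\land\gamma)$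 12. ${\sim}(\alpha\land(\beta\lor\gamma))\leftrightarrow{\sim}((\alpha\land\beta)\lor(\alpha\land\gamma))$ 13. ${\sim}(\alpha\lor(\beta\land\gamma))\leftrightarrow{\sim}((\alpha\lor\beta)\land(\alpha\lor\gamma))$ 14. ${\sim}{\sim}(\alpha\land\beta)\leftrightarrow({\sim}{\sim}\alpha\land{\sim}{\sim}\beta)$ 15. $\alpha\to{\sim}{\sim}\alpha$ 16. $\alpha\to({\sim}\alpha\to{\sim}(\alpha\to\alpha))$ 17. $(\alpha\to\beta)\to({\sim}{\sim}\alpha\to{\sim}{\sim}\beta)$ 18. ${\sim}\alpha\to{\sim}(\alpha\land\beta)$ 19. ${\sim}(\alpha\land\beta)\to{\sim}(\beta\land\alpha)$ 20. $({\sim}\alpha\to{\sim}\beta)\to({\sim}(\alpha\land\beta)\to{\sim}\beta)$ 21. $({\sim}\alpha\to{\sim}\beta)\to(({\sim}\gamma\to{\sim}\theta)\to({\sim}(\alpha\land\gamma)\to{\sim}(\beta\land\theta)))$ 22. ${\sim}{\sim}{\sim}\alpha\to{\sim}\alpha$ Put $E(\alpha):=\{\alpha\approx\alpha\to\alpha\}$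 and $\Delta(\alpha,\beta):=\{\alpha\to\beta,\ \beta\to\alpha,\ {\sim}\alpha\to{\sim}\beta,\ {\sim}\beta\to{\sim}\alpha\}$, and for a set $\Phi$ of formulas let $E(\Phi):=\bigcup_{\varphi\in\Phi}E(\varphi)$. An $\mathrm{Alg}^*(\mathbf{L}_{\mathrm{QN4}})$-algebra is an algebra $\mathbf A=\langle A;\land,\lor,\to,\sim\rangle$ of type $\langle 2,2,2,1\rangle$ that satisfies, for all formulas $\alpha,\beta$ and under all assignments: the equations $E(\varphi)$ for every axiom $\varphi$; the equations $E(\Delta(\alpha,\alpha))$; the quasi-equations "$E(\Delta(\alpha,\beta))$ implies $\alpha\approx\beta$"; and "$E(\alpha)$ and $E(\alpha\to\beta)$ imply $E(\beta)$". In an algebra $\mathbf A$ of this type write $|a|:=a\to a$; $a\preceq b$ iff $a\to b=|a\to b|$; and $a\equiv b$ iff $a\preceq b$ and $b\preceq a$. A Brouwerian algebra is a lattice with a binary operation $\to$ such that $a\land b\le c$ iff $a\le b\to c$; a nucleus on it is a unary operation $\Box$ with $\Box(a\land b)=\Box a\land\Box b$ and $a\le\Box a=\Box\Box a$. $\mathbf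 A$ is a quasi-N4-lattice if: * $\langle A;\land,\lor\rangle$ is a distributive lattice, with order $\le$; * $\equiv$ is a congruence on $\langle A;\land,\lor,\to\rangle$, the quotient $\langle A;\land,\lor,\to\rangle/{\equiv}$ is a Brouwerian algebra, and $\Box[a]:=[{\sim}{\sim}a]$ is a (well-defined) nucleus on it; * $a\le b$ iff $a\preceq b$ and ${\sim}b\preceq{\sim}a$; * ${\sim}(a\to b)\equiv{\sim}{\sim}(a\land{\sim}b)$; * $a\le{\sim}{\sim}a$, ${\sim}a={\sim}{\sim}{\sim}a$, ${\sim}(a\lor b)={\sim}a\land{\sim}b$ and ${\sim}{\sim}a\land{\sim}{\sim}b={\sim}{\sim}(a\land b)$ for all $a,b\in A$. **Corollary.** The class of quasi-N4-lattices and the class of $\mathrm{Alg}^*(\mathbf{L}_{\mathrm{QN4}})$-algebras coincide: an algebra $\langle A;\land,\lor,\to,\sim\rangle$ of type $\langle2,2,2,1\rangle$ is a quasi-N4-lattice if and only if it is an $\mathrm{Alg}^*(\mathbf{L}_{\mathrm{QN4}})$-algebra. Moreover, this class is the equivalent algebraic semantics of $\mathbf{L}_{\mathrm{QN4}}$ in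 the sense of Blok and Pigozzi, with defining equations $E$ and equivalence formulas $\Delta$: writing $K$ for it, $K$ is a quasivariety, and for every set $\Gamma\cup\{\varphi\}$ of formulas and all formulas $\alpha,\beta$, $$\Gamma\vdash_{\mathbf{L}_{\mathrm{QN4}}}\varphi\iff E(\Gamma)\models_K E(\varphi),\qquad \alpha\approx\beta\ \models_K\ E(\Delta(\alpha,\beta)),\qquad E(\Delta(\alpha,\beta))\ \models_K\ \alpha\approx\beta .$$ -/

import Mathlib

universe u

namespace QN4

/-! ### Formulas and the Hilbert calculus -/

/-- Formulas in the language `∧, ∨, →, ∼` over a denumerable set of variables. -/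
inductive Fm : Type
  | var : ℕ → Fm
  | neg : Fm → Fm
  | and : Fm → Fm → Fm
  | or : Fm → Fm → Fm
  | imp : Fm → Fm → Fm

namespace Fm

/-- `α ↔ β` abbreviates `(α → β) ∧ (β → α)`. -/
def iff (α β : Fm) : Fm := and (imp α β) (imp β α)

end Fm

open Fm in
/-- The set of (instances of) axiom schemes of the Hilbert calculus. -/
inductive IsAxiom : Fm → Prop
  | ax1 (α β : Fm) : IsAxiom (imp α (imp β α))
  | ax2 (α β γ : Fm) :
      IsAxiom (imp (imp α (imp β γ)) (imp (imp α β) (imp α γ)))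
  | ax3 (α β : Fm) : IsAxiom (imp (and α β) α)
  | ax4 (α β : Fm) : IsAxiom (imp (and α β) β)
  | ax5 (α β γ : Fm) :
      IsAxiom (imp (imp α β) (imp (imp α γ) (imp α (and β γ))))
  | ax6 (α β : Fm) : IsAxiom (imp α (or α β))
  | ax7 (α β : Fm) : IsAxiom (imp β (or α β))
  | ax8 (α β γ : Fm) :
      IsAxiom (imp (imp α γ) (imp (imp β γ) (imp (or α β) γ)))
  | ax9 (α β : Fm) : IsAxiom (iff (neg (or α β)) (and (neg α) (neg β)))
  | ax10 (α β : Fm) : IsAxiom (iff (neg (imp α β)) (neg (neg (and α (neg β)))))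
  | ax11 (α β γ : Fm) :
      IsAxiom (iff (neg (and α (and β γ))) (neg (and (and α β) γ)))
  | ax12 (α β γ : Fm) :
      IsAxiom (iff (neg (and α (or β γ))) (neg (or (and α β) (and α γ))))
  | ax13 (α β γ : Fm) :
      IsAxiom (iff (neg (or α (and β γ))) (neg (and (or α β) (or α γ))))
  | ax14 (α β : Fm) :
      IsAxiom (iff (neg (neg (and α β))) (and (neg (neg α)) (neg (neg β))))
  | ax15 (α : Fm) : IsAxiom (imp α (neg (neg α)))
  | ax16 (α : Fm) : IsAxiom (imp α (imp (neg α) (neg (imp α α))))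
  | ax17 (α β : Fm) :
      IsAxiom (imp (imp α β) (imp (neg (neg α)) (neg (neg β))))
  | ax18 (α β : Fm) : IsAxiom (imp (neg α) (neg (and α β)))
  | ax19 (α β : Fm) : IsAxiom (imp (neg (and α β)) (neg (and β α)))
  | ax20 (α β : Fm) :
      IsAxiom (imp (imp (neg α) (neg β)) (imp (neg (and α β)) (neg β)))
  | ax21 (α β γ θ : Fm) :
      IsAxiom (imp (imp (neg α) (neg β))
        (imp (imp (neg γ) (neg θ)) (imp (neg (and α γ)) (neg (and β θ)))))
  | ax22 (α : Fm) : IsAxiom (imp (neg (neg (neg α))) (neg α))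

/-- Derivability `Γ ⊢ φ` in the Hilbert calculus: the only rule is modus ponens. -/
inductive Derivable (Γ : Set Fm) : Fm → Prop
  | hyp {φ : Fm} : φ ∈ Γ → Derivable Γ φ
  | ax {φ : Fm} : IsAxiom φ → Derivable Γ φ
  | mp {φ ψ : Fm} : Derivable Γ φ → Derivable Γ (Fm.imp φ ψ) → Derivable Γ ψ

/-! ### Algebras of type `⟨2, 2, 2, 1⟩`, equations -/

/-- The structure of an algebra `⟨A; ∧, ∨, →, ∼⟩` of type `⟨2, 2, 2, 1⟩` on `A`
(no laws are assumed). -/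
class AlgOps (A : Type u) where
  meet : A → A → A
  join : A → A → A
  imp : A → A → A
  neg : A → A

/-- The value of a formula under an assignment of elements to variables. -/
def Fm.eval {A : Type u} [AlgOps A] (v : ℕ → A) : Fm → A
  | Fm.var n => v n
  | Fm.neg α => AlgOps.neg (Fm.eval v α)
  | Fm.and α β => AlgOps.meet (Fm.eval v α) (Fm.eval v β)
  | Fm.or α β => AlgOps.join (Fm.eval v α) (Fm.eval v β)
  | Fm.imp α β => AlgOps.imp (Fm.eval v α) (Fm.eval v β)

/-- An equation `α ≈ β`. -/
abbrev Eqn : Type := Fm × Fm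

/-- The assignment `v` satisfies an equation. -/
def Sat {A : Type u} [AlgOps A] (v : ℕ → A) (e : Eqn) : Prop :=
  e.1.eval v = e.2.eval v

/-- The defining equations `E(α) = {α ≈ α → α}`. -/
def E (α : Fm) : Set Eqn := {(α, Fm.imp α α)}

/-- The equivalence formulas
`Δ(α, β) = {α → β, β → α, ∼α → ∼β, ∼β → ∼α}`. -/
def Δ (α β : Fm) : Set Fm :=
  {Fm.imp α β, Fm.imp β α,
    Fm.imp (Fm.neg α) (Fm.neg β), Fm.imp (Fm.neg β) (Fm.neg α)}

/-- `E(Φ)`, the union of the sets `E(φ)` for `φ` in a set `Φ` of formulas. -/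
def ESet (E : Fm → Set Eqn) (Φ : Set Fm) : Set Eqn := {e | ∃ φ ∈ Φ, e ∈ E φ}

/-! ### The algebras of the calculus -/

/-- `A` is an `Alg*`-algebra of the calculus. -/
structure IsAlgStar (A : Type u) [AlgOps A] : Prop where
  /-- The equations `E(φ)` for every axiom `φ`. -/
  axioms_valid : ∀ φ : Fm, IsAxiom φ → ∀ v : ℕ → A, ∀ e ∈ E φ, Sat v e
  /-- The equations `E(Δ(α, α))`. -/
  refl_valid : ∀ (α : Fm) (v : ℕ → A), ∀ e ∈ ESet E (Δ α α), Sat v e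
  /-- `E(Δ(α, β))` implies `α ≈ β`. -/
  separated : ∀ (α β : Fm) (v : ℕ → A),
    (∀ e ∈ ESet E (Δ α β), Sat v e) → Sat v (α, β)
  /-- `E(α)` and `E(α → β)` imply `E(β)`. -/
  modus_ponens : ∀ (α β : Fm) (v : ℕ → A), (∀ e ∈ E α, Sat v e) →
    (∀ e ∈ E (Fm.imp α β), Sat v e) → ∀ e ∈ E β, Sat v e

/-! ### Quasi-N4-lattices -/

/-- `⟨B; inf, sup⟩` is a lattice. -/
structure IsLatticeOps {B : Type u} (inf sup : B → B → B) : Prop where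
  inf_comm : ∀ a b, inf a b = inf b a
  sup_comm : ∀ a b, sup a b = sup b a
  inf_assoc : ∀ a b c, inf (inf a b) c = inf a (inf b c)
  sup_assoc : ∀ a b c, sup (sup a b) c = sup a (sup b c)
  inf_sup_self : ∀ a b, inf a (sup a b) = a
  sup_inf_self : ∀ a b, sup a (inf a b) = a

/-- The lattice order determined by a meet operation. -/
def OpLE {B : Type u} (inf : B → B → B) (a b : B) : Prop := inf a b = a

/-- `⟨B; inf, sup⟩` is a distributive lattice. -/
structure IsDistribLatticeOps {B : Type u} (inf sup : B → B → B) : Prop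
    extends IsLatticeOps inf sup where
  inf_sup_left : ∀ a b c, inf a (sup b c) = sup (inf a b) (inf a c)

/-- `⟨B; inf, sup, imp⟩` is a Brouwerian algebra: a lattice in which
`imp` is the residuum of the meet. -/
structure IsBrouwerian {B : Type u} (inf sup imp : B → B → B) : Prop
    extends IsLatticeOps inf sup where
  residuation : ∀ a b c, OpLE inf (inf a b) c ↔ OpLE inf a (imp b c)

/-- `box` is a nucleus for the meet operation `inf`. -/
structure IsNucleus {B : Type u} (inf : B → B → B) (box : B → B) : Prop where
  map_inf : ∀ a b, box (inf a b) = inf (box a) (box b)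
  le_box : ∀ a, OpLE inf a (box a)
  box_box : ∀ a, box a = box (box a)

section

variable {A : Type u} [AlgOps A]

/-- `|a| = a → a`. -/
def absv (a : A) : A := AlgOps.imp a a

/-- `a ⪯ b` iff `a → b = |a → b|`. -/
def Prec (a b : A) : Prop := AlgOps.imp a b = absv (AlgOps.imp a b)

/-- `a ≡ b` iff `a ⪯ b` and `b ⪯ a`. -/
def Equi (a b : A) : Prop := Prec a b ∧ Prec b a

end

/-- The relation `≡` is a congruence on the reduct `⟨A; ∧, ∨, →⟩`. -/
structure IsReductCongruence (A : Type u) [AlgOps A] : Prop where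
  equivalence : Equivalence (Equi : A → A → Prop)
  meet : ∀ ⦃a b : A⦄, Equi a b → ∀ ⦃c d : A⦄, Equi c d →
    Equi (AlgOps.meet a c) (AlgOps.meet b d)
  join : ∀ ⦃a b : A⦄, Equi a b → ∀ ⦃c d : A⦄, Equi c d →
    Equi (AlgOps.join a c) (AlgOps.join b d)
  imp : ∀ ⦃a b : A⦄, Equi a b → ∀ ⦃c d : A⦄, Equi c d →
    Equi (AlgOps.imp a c) (AlgOps.imp b d)

namespace IsReductCongruence

variable {A : Type u} [AlgOps A] (h : IsReductCongruence A)

/-- The carrier `A / ≡` of the quotient algebra `B(A)`. -/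
def Carrier : Type u :=
  Quotient (⟨Equi, h.equivalence⟩ : Setoid A)

/-- The meet of `B(A)`. -/
def qmeet : h.Carrier → h.Carrier → h.Carrier :=
  Quotient.map₂ AlgOps.meet h.meet

/-- The join of `B(A)`. -/
def qjoin : h.Carrier → h.Carrier → h.Carrier :=
  Quotient.map₂ AlgOps.join h.join

/-- The implication of `B(A)`. -/
def qimp : h.Carrier → h.Carrier → h.Carrier :=
  Quotient.map₂ AlgOps.imp h.imp

/-- The operator `□[a] = [∼∼a]` on `B(A)`, given that it is well defined. -/
def qbox (hb : ∀ a b : A, Equi a b →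
    Equi (AlgOps.neg (AlgOps.neg a)) (AlgOps.neg (AlgOps.neg b))) :
    h.Carrier → h.Carrier :=
  Quotient.map (fun a => AlgOps.neg (AlgOps.neg a)) hb

end IsReductCongruence

open AlgOps in
/-- `A` is a quasi-N4-lattice. -/
structure IsQN4Lattice (A : Type u) [AlgOps A] : Prop where
  /-- `⟨A; ∧, ∨⟩` is a distributive lattice. -/
  distribLattice : IsDistribLatticeOps (meet : A → A → A) join
  /-- `≡` is a congruence on `⟨A; ∧, ∨, →⟩`, the quotient is a Brouwerian algebra, and
  `□[a] = [∼∼a]` is a (well-defined) nucleus on it. -/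
  quotient : ∃ h : IsReductCongruence A,
    IsBrouwerian h.qmeet h.qjoin h.qimp ∧
    ∃ hb : ∀ a b : A, Equi a b → Equi (neg (neg a)) (neg (neg b)),
      IsNucleus h.qmeet (h.qbox hb)
  /-- `a ≤ b` iff `a ⪯ b` and `∼b ⪯ ∼a`. -/
  le_iff : ∀ a b : A, OpLE meet a b ↔ Prec a b ∧ Prec (neg b) (neg a)
  /-- `∼(a → b) ≡ ∼∼(a ∧ ∼b)`. -/
  neg_imp : ∀ a b : A, Equi (neg (imp a b)) (neg (neg (meet a (neg b))))
  /-- `a ≤ ∼∼a`. -/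
  le_neg_neg : ∀ a : A, OpLE meet a (neg (neg a))
  /-- `∼a = ∼∼∼a`. -/
  neg_eq : ∀ a : A, neg a = neg (neg (neg a))
  /-- `∼(a ∨ b) = ∼a ∧ ∼b`. -/
  neg_join : ∀ a b : A, neg (join a b) = meet (neg a) (neg b)
  /-- `∼∼a ∧ ∼∼b = ∼∼(a ∧ b)`. -/
  neg_neg_meet : ∀ a b : A,
    meet (neg (neg a)) (neg (neg b)) = neg (neg (meet a b))

/-! ### Equivalent algebraic semantics -/

/-- A class of algebras of type `⟨2, 2, 2, 1⟩`. -/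
abbrev AlgClass : Type (u + 1) := (A : Type u) → AlgOps A → Prop

/-- The consequence relation `Θ ⊨_K e` between equations. -/
def EqCons (K : AlgClass.{u}) (Θ : Set Eqn) (e : Eqn) : Prop :=
  ∀ (A : Type u) [inst : AlgOps A], K A inst →
    ∀ v : ℕ → A, (∀ t ∈ Θ, Sat v t) → Sat v e

/-- `K` is the class of all models of a set of quasi-equations
(finitely many premises, one conclusion). -/
def IsQuasivariety (K : AlgClass.{u}) : Prop :=
  ∃ Q : Set (List Eqn × Eqn), ∀ (A : Type u) [inst : AlgOps A],
    K A inst ↔ ∀ q ∈ Q, ∀ v : ℕ → A, (∀ t ∈ q.1, Sat v t) → Sat v q.2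

/-- The quasivariety `K` is the equivalent algebraic semantics, in the sense of Blok and
Pigozzi, of the consequence relation `L`, with defining equations `E` and
equivalence formulas `D`. -/
structure IsEquivAlgSemantics (L : Set Fm → Fm → Prop) (E : Fm → Set Eqn)
    (D : Fm → Fm → Set Fm) (K : AlgClass.{u}) : Prop where
  quasivariety : IsQuasivariety K
  /-- `Γ ⊢ φ` iff `E(Γ) ⊨_K E(φ)`. -/
  complete : ∀ (Γ : Set Fm) (φ : Fm),
    L Γ φ ↔ ∀ e ∈ E φ, EqCons K (ESet E Γ) e
  /-- `α ≈ β ⊨_K E(Δ(α, β))`. -/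
  eq_to : ∀ α β : Fm, ∀ e ∈ ESet E (D α β), EqCons K {(α, β)} e
  /-- `E(Δ(α, β)) ⊨_K α ≈ β`. -/
  to_eq : ∀ α β : Fm, EqCons K (ESet E (D α β)) (α, β)

end QN4

/-!
The proof rests on twist representations. Let `H` be a generalized Heyting algebra (the same thing
as a Brouwerian algebra), `j` a nucleus on it, and represent an element `a` of an algebra by the
pair `(q a, q (∼a))` of elements of `H`. In a quasi-N4-lattice, with `H` the quotient by `≡` and
`j = □`, the component `q (∼a)` is fixed by `j`, and the
operations act on these pairs as in a twist structure:
`∼(a ∧ b)` is represented by `j (q (∼a) ⊔ q (∼b))`, `∼(a ∨ b)` by the meet of `q (∼a)` and `q (∼b)`,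
`∼(a → b)` by `j (q a ⊓ q (∼b))`, and `∼∼a` by `j (q a)`. Such a map `q` is a `TwistRep`, and it is
faithful if the pair determines the element.

Both classes consist of the algebras with a faithful twist representation:

* `IsQN4Lattice.twistRep` gives one for a quasi-N4-lattice; the law for `∼(a ∧ b)` follows from
  `∼(a ∧ b) = ∼(∼∼a ∧ ∼∼b) = ∼∼(∼a ∨ ∼b)`.
* `IsFilter.twistRep` gives one for any set `D` of elements that contains the values of all axioms
  and is closed under modus ponens: `H` is the quotient by `a → b, b → a ∈ D`. For an
  `Alg*`-algebra, with `D` the set of solutions of `x = x → x`, it is faithful by separation.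
* Conversely `TwistRep.isQN4Lattice` and `TwistRep.isAlgStar` verify the laws of both classes by
  computing in `H`; here `x = x → x` means `q x = ⊤`, and `a ⪯ b` means `q a ≤ q b`.

For completeness of the calculus, take `D` to be the theory of `Γ` in the formula algebra. Its
twist representation is a homomorphism to the algebra `Twist j` of all pairs over its quotient,
which is an `Alg*`-algebra in which exactly the consequences of `Γ` are sent to pairs with first
component `⊤`.
-/

namespace QN4

open AlgOps

/-! ### Twist representations -/

/-- `q` represents the algebra `A` in a twist structure over `H` with nucleus `j`, the element `a`
being sent to the pair `(q a, q (∼a))`. -/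
structure TwistRep {A H : Type*} [AlgOps A] [GeneralizedHeytingAlgebra H] (j : Nucleus H)
    (q : A → H) : Prop where
  map_meet : ∀ a b, q (meet a b) = q a ⊓ q b
  map_join : ∀ a b, q (join a b) = q a ⊔ q b
  map_imp : ∀ a b, q (imp a b) = q a ⇨ q b
  map_neg_neg : ∀ a, q (neg (neg a)) = j (q a)
  neg_meet : ∀ a b, q (neg (meet a b)) = j (q (neg a) ⊔ q (neg b))
  neg_join : ∀ a b, q (neg (join a b)) = q (neg a) ⊓ q (neg b)
  neg_imp : ∀ a b, q (neg (imp a b)) = j (q a ⊓ q (neg b))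
  box_neg : ∀ a, j (q (neg a)) = q (neg a)

/-- The pair `(q a, q (∼a))` determines `a`. -/
def Faithful {A H : Type*} [AlgOps A] (q : A → H) : Prop :=
  ∀ a b, q a = q b → q (neg a) = q (neg b) → a = b

theorem box_box_sup {H : Type*} [GeneralizedHeytingAlgebra H] (j : Nucleus H) (x y : H) :
    j (j x ⊔ y) = j (x ⊔ y) := by
  apply le_antisymm
  · rw [← j.idempotent (x ⊔ y)]
    exact j.monotone (sup_le (j.monotone le_sup_left) (le_sup_right.trans j.le_apply))
  · exact j.monotone (sup_le_sup_right j.le_apply y)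

theorem box_sup_box {H : Type*} [GeneralizedHeytingAlgebra H] (j : Nucleus H) (x y : H) :
    j (x ⊔ j y) = j (x ⊔ y) := by
  rw [sup_comm, box_box_sup, sup_comm]

namespace TwistRep

variable {A H : Type*} [AlgOps A] [GeneralizedHeytingAlgebra H] {j : Nucleus H} {q : A → H}

/-- Every axiom takes the value `⊤` under a twist representation. -/
theorem eval_isAxiom (h : TwistRep j q) {φ : Fm} (hφ : IsAxiom φ) (v : ℕ → A) :
    q (φ.eval v) = ⊤ := by
  -- The inequality behind the axioms that derive a negated conclusion from an implication.
  have box_mp : ∀ p x y : H, p ⊓ x ≤ y → p ⊓ j x ≤ j y := fun p x y hp =>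
    (inf_le_inf_right _ j.le_apply).trans (j.map_inf ▸ j.monotone hp)
  cases hφ <;>
    simp only [Fm.eval, Fm.iff, h.map_meet, h.map_join, h.map_imp, h.map_neg_neg, h.neg_meet,
      h.neg_join, h.neg_imp, h.box_neg, j.map_inf, himp_eq_top_iff, inf_eq_top_iff, le_himp_iff,
      inf_idem, le_refl]
  case ax1 => exact inf_le_left
  case ax2 α β γ =>
    set x := q (α.eval v); set y := q (β.eval v); set z := q (γ.eval v)
    have h1 : (x ⇨ y ⇨ z) ⊓ x ≤ y ⇨ z := himp_inf_le
    have h2 : (x ⇨ y) ⊓ x ≤ y := himp_inf_le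
    calc _ ≤ ((x ⇨ y ⇨ z) ⊓ x) ⊓ ((x ⇨ y) ⊓ x) := by
            rw [← inf_inf_distrib_right]
      _ ≤ (y ⇨ z) ⊓ y := inf_le_inf h1 h2
      _ ≤ z := himp_inf_le
  case ax3 => exact inf_le_left
  case ax4 => exact inf_le_right
  case ax5 =>
    exact le_inf ((inf_le_inf_right _ inf_le_left).trans himp_inf_le)
      ((inf_le_inf_right _ inf_le_right).trans himp_inf_le)
  case ax6 => exact le_sup_left
  case ax7 => exact le_sup_right
  case ax8 =>
    rw [inf_sup_left]
    exact sup_le ((inf_le_inf_right _ inf_le_left).trans himp_inf_le)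
      ((inf_le_inf_right _ inf_le_right).trans himp_inf_le)
  case ax11 => simp only [box_box_sup, box_sup_box, sup_assoc, le_refl, and_self]
  case ax12 => simp only [← j.map_inf, ← sup_inf_left, le_refl, and_self]
  case ax13 => simp only [← inf_sup_left, h.box_neg, j.map_inf, le_refl, and_self]
  case ax15 => exact j.le_apply
  case ax16 => exact inf_le_inf_right _ j.le_apply
  case ax17 => exact box_mp _ _ _ himp_inf_le
  case ax18 => exact le_sup_left.trans j.le_apply
  case ax19 => rw [sup_comm]
  case ax20 α β =>
    rw [← h.box_neg (β.eval v), box_sup_box, h.box_neg]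
    refine (box_mp _ _ (q (neg (β.eval v))) ?_).trans_eq (h.box_neg _)
    rw [inf_sup_left]
    exact sup_le himp_inf_le inf_le_right
  case ax21 =>
    apply box_mp
    rw [inf_sup_left]
    exact sup_le_sup ((inf_le_inf_right _ inf_le_left).trans himp_inf_le)
      ((inf_le_inf_right _ inf_le_right).trans himp_inf_le)

theorem eq_imp_self_iff (h : TwistRep j q) (hq : Faithful q) {x : A} :
    x = imp x x ↔ q x = ⊤ := by
  refine ⟨fun hx => ?_, fun hx => hq _ _ ?_ ?_⟩
  · rw [hx, h.map_imp, himp_self]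
  · rw [h.map_imp, himp_self, hx]
  · rw [h.neg_imp, hx, top_inf_eq, h.box_neg]

theorem prec_iff (h : TwistRep j q) (hq : Faithful q) {a b : A} : Prec a b ↔ q a ≤ q b := by
  rw [Prec, absv, h.eq_imp_self_iff hq, h.map_imp, himp_eq_top_iff]

theorem equi_iff (h : TwistRep j q) (hq : Faithful q) {a b : A} : Equi a b ↔ q a = q b := by
  rw [Equi, h.prec_iff hq, h.prec_iff hq, le_antisymm_iff]

theorem opLE_iff (h : TwistRep j q) (hq : Faithful q) {a b : A} :
    OpLE meet a b ↔ q a ≤ q b ∧ q (neg b) ≤ q (neg a) := by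
  refine ⟨fun hab => ⟨?_, ?_⟩, fun hab => hq _ _ ?_ ?_⟩
  · rw [← show meet a b = a from hab, h.map_meet]
    exact inf_le_right
  · rw [← show meet a b = a from hab, h.neg_meet]
    exact le_sup_right.trans j.le_apply
  · rw [h.map_meet, inf_eq_left.2 hab.1]
  · rw [h.neg_meet, sup_eq_left.2 hab.2, h.box_neg]

theorem isAlgStar {A : Type u} [AlgOps A] {q : A → H} (h : TwistRep j q) (hq : Faithful q) :
    IsAlgStar A where
  axioms_valid φ hφ v e he := by
    obtain rfl : e = _ := he
    exact (h.eq_imp_self_iff hq).2 (h.eval_isAxiom hφ v)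
  refl_valid α v e he := by
    obtain ⟨φ, hφ, rfl : e = _⟩ := he
    refine (h.eq_imp_self_iff hq).2 ?_
    rcases hφ with rfl | rfl | rfl | rfl <;> exact (h.map_imp _ _).trans himp_self
  separated α β v hv := by
    have key : ∀ φ ψ : Fm, Fm.imp φ ψ ∈ Δ α β → q (φ.eval v) ≤ q (ψ.eval v) := fun φ ψ hm =>
      (h.prec_iff hq).1 (hv _ ⟨_, hm, rfl⟩)
    exact hq _ _
      (le_antisymm (key α β (by simp [Δ])) (key β α (by simp [Δ])))
      (le_antisymm (key α.neg β.neg (by simp [Δ])) (key β.neg α.neg (by simp [Δ])))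
  modus_ponens α β v h1 h2 e he := by
    obtain rfl : e = _ := he
    have h1 : q (α.eval v) = ⊤ := (h.eq_imp_self_iff hq).1 (h1 _ rfl)
    have h2 : q (α.eval v) ≤ q (β.eval v) := (h.prec_iff hq).1 (h2 _ rfl)
    exact (h.eq_imp_self_iff hq).2 (top_le_iff.1 (h1 ▸ h2))

theorem isReductCongruence {A : Type u} [AlgOps A] {q : A → H} (h : TwistRep j q)
    (hq : Faithful q) : IsReductCongruence A where
  equivalence :=
    ⟨fun _ => (h.equi_iff hq).2 rfl,
      fun hab => (h.equi_iff hq).2 ((h.equi_iff hq).1 hab).symm,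
      fun hab hbc => (h.equi_iff hq).2 (((h.equi_iff hq).1 hab).trans ((h.equi_iff hq).1 hbc))⟩
  meet _ _ hab _ _ hcd := by
    rw [h.equi_iff hq] at *
    rw [h.map_meet, h.map_meet, hab, hcd]
  join _ _ hab _ _ hcd := by
    rw [h.equi_iff hq] at *
    rw [h.map_join, h.map_join, hab, hcd]
  imp _ _ hab _ _ hcd := by
    rw [h.equi_iff hq] at *
    rw [h.map_imp, h.map_imp, hab, hcd]

theorem isQN4Lattice {A : Type u} [AlgOps A] {q : A → H} (h : TwistRep j q) (hq : Faithful q) :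
    IsQN4Lattice A where
  distribLattice :=
    { inf_comm := fun a b => hq _ _
        (by simp only [h.map_meet, inf_comm]) (by simp only [h.neg_meet, sup_comm])
      sup_comm := fun a b => hq _ _
        (by simp only [h.map_join, sup_comm]) (by simp only [h.neg_join, inf_comm])
      inf_assoc := fun a b c => hq _ _
        (by simp only [h.map_meet, inf_assoc])
        (by simp only [h.neg_meet, box_box_sup, box_sup_box, sup_assoc])
      sup_assoc := fun a b c => hq _ _
        (by simp only [h.map_join, sup_assoc]) (by simp only [h.neg_join, inf_assoc])
      inf_sup_self := fun a b => hq _ _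
        (by simp only [h.map_meet, h.map_join, inf_sup_self])
        (by simp only [h.neg_meet, h.neg_join, sup_inf_self, h.box_neg])
      sup_inf_self := fun a b => hq _ _
        (by simp only [h.map_meet, h.map_join, sup_inf_self])
        (by
          simp only [h.neg_meet, h.neg_join]
          exact inf_eq_left.2 (le_sup_left.trans j.le_apply))
      inf_sup_left := fun a b c => hq _ _
        (by simp only [h.map_meet, h.map_join, inf_sup_left])
        (by simp only [h.neg_meet, h.neg_join, sup_inf_left, j.map_inf]) }
  quotient := by
    have hC := h.isReductCongruence hq
    have sound : ∀ {a b : A}, q a = q b →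
        (Quotient.mk (⟨Equi, hC.equivalence⟩ : Setoid A) a) = Quotient.mk _ b := fun hab =>
      Quotient.sound ((h.equi_iff hq).2 hab)
    have hle : ∀ a b : A,
        OpLE hC.qmeet (Quotient.mk _ a) (Quotient.mk _ b) ↔ q a ≤ q b := fun a b => by
      refine ⟨fun hab => ?_, fun hab => sound ?_⟩
      · have := (h.equi_iff hq).1 (Quotient.exact hab)
        rw [h.map_meet] at this
        exact inf_eq_left.1 this
      · rw [h.map_meet, inf_eq_left.2 hab]
    have hb : ∀ a b : A, Equi a b → Equi (neg (neg a)) (neg (neg b)) := fun a b hab => by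
      rw [h.equi_iff hq] at *
      rw [h.map_neg_neg, h.map_neg_neg, hab]
    refine ⟨hC, ⟨⟨?_, ?_, ?_, ?_, ?_, ?_⟩, ?_⟩, hb, ?_, ?_, ?_⟩
    · rintro ⟨a⟩ ⟨b⟩
      exact sound (by simp only [h.map_meet, inf_comm])
    · rintro ⟨a⟩ ⟨b⟩
      exact sound (by simp only [h.map_join, sup_comm])
    · rintro ⟨a⟩ ⟨b⟩ ⟨c⟩
      exact sound (by simp only [h.map_meet, inf_assoc])
    · rintro ⟨a⟩ ⟨b⟩ ⟨c⟩
      exact sound (by simp only [h.map_join, sup_assoc])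
    · rintro ⟨a⟩ ⟨b⟩
      exact sound (by simp only [h.map_meet, h.map_join, inf_sup_self])
    · rintro ⟨a⟩ ⟨b⟩
      exact sound (by simp only [h.map_meet, h.map_join, sup_inf_self])
    · rintro ⟨a⟩ ⟨b⟩ ⟨c⟩
      refine (hle (meet a b) c).trans (Iff.trans ?_ (hle a (imp b c)).symm)
      rw [h.map_meet, h.map_imp, le_himp_iff]
    · rintro ⟨a⟩ ⟨b⟩
      exact sound (by simp only [h.map_meet, h.map_neg_neg, j.map_inf])
    · rintro ⟨a⟩
      refine (hle a (neg (neg a))).2 ?_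
      rw [h.map_neg_neg]
      exact j.le_apply
    · rintro ⟨a⟩
      exact sound (by simp only [h.map_neg_neg, j.idempotent])
  le_iff a b := by rw [h.opLE_iff hq, h.prec_iff hq, h.prec_iff hq]
  neg_imp a b := by rw [h.equi_iff hq, h.neg_imp, h.map_neg_neg, h.map_meet]
  le_neg_neg a := by
    rw [h.opLE_iff hq, h.map_neg_neg, h.map_neg_neg, h.box_neg]
    exact ⟨j.le_apply, le_rfl⟩
  neg_eq a := hq _ _ (by simp only [h.map_neg_neg, h.box_neg])
    (by simp only [h.map_neg_neg, j.idempotent])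
  neg_join a b := hq _ _ (by rw [h.neg_join, h.map_meet])
    (by rw [h.map_neg_neg, h.map_join, h.neg_meet, h.map_neg_neg, h.map_neg_neg, box_box_sup,
      box_sup_box])
  neg_neg_meet a b := hq _ _ (by simp only [h.map_meet, h.map_neg_neg, j.map_inf])
    (by simp only [h.neg_meet, h.map_neg_neg, h.box_neg, j.idempotent])

end TwistRep

/-! ### The twist representation of a quasi-N4-lattice -/

/-- A nonempty Brouwerian algebra is a generalized Heyting algebra, with greatest element
`b → b`. -/
@[reducible]
noncomputable def IsBrouwerian.toGeneralizedHeyting {B : Type u} [Nonempty B]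
    {inf sup himp : B → B → B} (h : IsBrouwerian inf sup himp) : GeneralizedHeytingAlgebra B :=
  have antisymm : ∀ a b, OpLE inf a b → OpLE inf b a → a = b := fun a b hab hba =>
    hab.symm.trans ((h.inf_comm a b).trans hba)
  have idem : ∀ a, inf a a = a := fun a => by
    conv_lhs => rw [← h.sup_inf_self a a, h.sup_inf_self a a]
    conv_lhs => arg 2; rw [← h.sup_inf_self a a]
    exact h.inf_sup_self a _
  have inf_le_right : ∀ a b, OpLE inf (inf a b) b := fun a b => by
    rw [OpLE, h.inf_assoc, idem]
  have inf_le_left : ∀ a b, OpLE inf (inf a b) a := fun a b => by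
    rw [h.inf_comm]
    exact inf_le_right b a
  have sup_eq : ∀ a b, OpLE inf a b → sup a b = b := fun a b hab => by
    rw [← show inf a b = a from hab, h.sup_comm, h.inf_comm, h.sup_inf_self]
  have le_of_sup_eq : ∀ a b, sup a b = b → OpLE inf a b := fun a b hab => by
    rw [OpLE, ← hab, h.inf_sup_self]
  { le := OpLE inf
    le_refl := idem
    le_trans := fun a b c hab hbc => by
      rw [OpLE, ← show inf a b = a from hab, h.inf_assoc, show inf b c = b from hbc]
    le_antisymm := antisymm
    sup := sup
    le_sup_left := h.inf_sup_self
    le_sup_right := fun a b => by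
      rw [h.sup_comm]
      exact h.inf_sup_self b a
    sup_le := fun a b c hac hbc => le_of_sup_eq _ _ (by
      rw [h.sup_assoc, sup_eq b c hbc, sup_eq a c hac])
    inf := inf
    inf_le_left := inf_le_left
    inf_le_right := inf_le_right
    le_inf := fun a b c hab hac => by
      rw [OpLE, ← h.inf_assoc, show inf a b = a from hab, show inf a c = a from hac]
    top := himp (Classical.arbitrary B) (Classical.arbitrary B)
    le_top := fun a => (h.residuation _ _ _).1 (inf_le_right _ _)
    himp := himp
    le_himp_iff := fun a b c => (h.residuation a b c).symm }

/-- `IsNucleus` as a nucleus on the generalized Heyting algebra of a Brouwerian algebra. -/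
@[reducible]
noncomputable def IsNucleus.toNucleus {B : Type u} [Nonempty B] {inf sup himp : B → B → B}
    {box : B → B} (hB : IsBrouwerian inf sup himp) (h : IsNucleus inf box) :
    letI := hB.toGeneralizedHeyting
    Nucleus B :=
  letI := hB.toGeneralizedHeyting
  { toFun := box
    map_inf' := h.map_inf
    idempotent' := fun x => (h.box_box x).symm.le
    le_apply' := h.le_box }

theorem IsQN4Lattice.twistRep {A : Type u} [AlgOps A] [Nonempty A] (h : IsQN4Lattice A) :
    ∃ (H : Type u) (_ : GeneralizedHeytingAlgebra H) (j : Nucleus H) (q : A → H),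
      TwistRep j q ∧ Faithful q := by
  obtain ⟨hC, hB, hb, hN⟩ := h.quotient
  let q : A → hC.Carrier := Quotient.mk _
  have : Nonempty hC.Carrier := ⟨q (Classical.arbitrary A)⟩
  have sound : ∀ {a b : A}, Equi a b → q a = q b := fun hab => Quotient.sound hab
  have exact : ∀ {a b : A}, q a = q b → Equi a b := fun hab => Quotient.exact hab
  let _ := hB.toGeneralizedHeyting
  refine ⟨hC.Carrier, inferInstance, hN.toNucleus hB, q, ?_, ?_⟩
  · exact
      { map_meet := fun _ _ => rfl
        map_join := fun _ _ => rfl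
        map_imp := fun _ _ => rfl
        map_neg_neg := fun _ => rfl
        neg_meet := fun a b => by
          have : neg (meet a b) = neg (neg (join (neg a) (neg b))) := by
            rw [h.neg_join, h.neg_neg_meet, ← h.neg_eq]
          rw [this]
          rfl
        neg_join := fun a b => by
          rw [h.neg_join]
          rfl
        neg_imp := fun a b => sound (h.neg_imp a b)
        box_neg := fun a => congrArg q (h.neg_eq a).symm }
  · intro a b hab hnab
    have h1 : meet a b = a := (h.le_iff a b).2 ⟨(exact hab).1, (exact hnab).2⟩
    have h2 : meet b a = b := (h.le_iff b a).2 ⟨(exact hab).2, (exact hnab).1⟩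
    rw [← h1, h.distribLattice.inf_comm, h2]

/-! ### The twist representation of a filter -/

/-- `D` contains all values of axioms and is closed under modus ponens. -/
structure IsFilter {A : Type u} [AlgOps A] (D : A → Prop) : Prop where
  ax : ∀ φ : Fm, IsAxiom φ → ∀ v : ℕ → A, D (φ.eval v)
  mp : ∀ {a b : A}, D a → D (imp a b) → D b

/-- The assignment of `a`, `b`, `c`, `d` to the first four variables, used to instantiate axiom
schemes at elements. -/
def assign {A : Type u} (a b c d : A) : ℕ → A
  | 0 => a
  | 1 => b
  | 2 => c
  | _ => d

namespace IsFilter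

variable {A : Type u} [AlgOps A] {D : A → Prop}

theorem imp_const (h : IsFilter D) {a : A} (b : A) (ha : D a) : D (imp b a) :=
  h.mp ha (h.ax _ (.ax1 (.var 0) (.var 1)) (assign a b a a))

theorem imp_distrib (h : IsFilter D) {a b c : A} (h1 : D (imp a (imp b c))) (h2 : D (imp a b)) :
    D (imp a c) :=
  h.mp h2 (h.mp h1 (h.ax _ (.ax2 (.var 0) (.var 1) (.var 2)) (assign a b c c)))

theorem imp_refl (h : IsFilter D) (a : A) : D (imp a a) :=
  h.imp_distrib (h.ax _ (.ax1 (.var 0) (.imp (.var 0) (.var 0))) (assign a a a a))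
    (h.ax _ (.ax1 (.var 0) (.var 0)) (assign a a a a))

theorem imp_trans (h : IsFilter D) {a b c : A} (h1 : D (imp a b)) (h2 : D (imp b c)) :
    D (imp a c) :=
  h.imp_distrib (h.imp_const a h2) h1

theorem meet_left (h : IsFilter D) (a b : A) : D (imp (meet a b) a) :=
  h.ax _ (.ax3 (.var 0) (.var 1)) (assign a b a a)

theorem meet_right (h : IsFilter D) (a b : A) : D (imp (meet a b) b) :=
  h.ax _ (.ax4 (.var 0) (.var 1)) (assign a b a a)

theorem imp_meet (h : IsFilter D) {a b c : A} (h1 : D (imp a b)) (h2 : D (imp a c)) :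
    D (imp a (meet b c)) :=
  h.mp h2 (h.mp h1 (h.ax _ (.ax5 (.var 0) (.var 1) (.var 2)) (assign a b c c)))

theorem join_left (h : IsFilter D) (a b : A) : D (imp a (join a b)) :=
  h.ax _ (.ax6 (.var 0) (.var 1)) (assign a b a a)

theorem join_right (h : IsFilter D) (a b : A) : D (imp b (join a b)) :=
  h.ax _ (.ax7 (.var 0) (.var 1)) (assign a b a a)

theorem join_imp (h : IsFilter D) {a b c : A} (h1 : D (imp a c)) (h2 : D (imp b c)) :
    D (imp (join a b) c) :=
  h.mp h2 (h.mp h1 (h.ax _ (.ax8 (.var 0) (.var 1) (.var 2)) (assign a b c c)))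

theorem imp_imp_iff (h : IsFilter D) {a b c : A} :
    D (imp a (imp b c)) ↔ D (imp (meet a b) c) := by
  constructor
  · exact fun h1 => h.imp_distrib (h.imp_trans (h.meet_left a b) h1) (h.meet_right a b)
  · intro h1
    -- Compose `a → (b → a)` with `(b → a) → (b → (a ∧ b))`, and then with `(a ∧ b) → c`.
    have h2 : D (imp (imp b a) (imp b (meet a b))) :=
      h.imp_distrib
        (h.ax _ (.ax5 (.var 0) (.var 1) (.var 2)) (assign b a b b))
        (h.imp_const _ (h.imp_refl b))
    have h3 : D (imp (imp b (meet a b)) (imp b c)) :=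
      h.mp (h.imp_const b h1)
        (h.ax _ (.ax2 (.var 0) (.var 1) (.var 2)) (assign b (meet a b) c c))
    exact h.imp_trans (h.ax _ (.ax1 (.var 0) (.var 1)) (assign a b b b)) (h.imp_trans h2 h3)

theorem neg_neg_mono (h : IsFilter D) {a b : A} (hab : D (imp a b)) :
    D (imp (neg (neg a)) (neg (neg b))) :=
  h.mp hab (h.ax _ (.ax17 (.var 0) (.var 1)) (assign a b a a))

theorem imp_neg_neg (h : IsFilter D) (a : A) : D (imp a (neg (neg a))) :=
  h.ax _ (.ax15 (.var 0)) (assign a a a a)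

theorem neg_neg_neg_imp (h : IsFilter D) (a : A) : D (imp (neg (neg (neg a))) (neg a)) :=
  h.ax _ (.ax22 (.var 0)) (assign a a a a)

/-- `a` and `b` are identified if `D` contains both implications between them. -/
def setoid (h : IsFilter D) : Setoid A where
  r a b := D (imp a b) ∧ D (imp b a)
  iseqv :=
    ⟨fun a => ⟨h.imp_refl a, h.imp_refl a⟩, fun hab => ⟨hab.2, hab.1⟩,
      fun hab hbc => ⟨h.imp_trans hab.1 hbc.1, h.imp_trans hbc.2 hab.2⟩⟩

/-- The quotient of the reduct `⟨A; ∧, ∨, →⟩` by the filter `D`. -/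
def Quo (h : IsFilter D) : Type u := Quotient h.setoid

/-- The projection to the quotient by a filter. -/
def proj (h : IsFilter D) (a : A) : h.Quo := Quotient.mk h.setoid a

theorem proj_eq (h : IsFilter D) {a b : A} : h.proj a = h.proj b ↔ D (imp a b) ∧ D (imp b a) :=
  ⟨fun hab => Quotient.exact hab, fun hab => Quotient.sound (s := h.setoid) hab⟩

theorem ind (h : IsFilter D) {P : h.Quo → Prop} (hP : ∀ a, P (h.proj a)) (x : h.Quo) : P x :=
  Quotient.ind hP x

/-- The positive axioms make the quotient by a filter a generalized Heyting algebra, ordered by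
`[a] ≤ [b]` iff `a → b ∈ D`. -/
noncomputable instance [Nonempty A] (h : IsFilter D) : GeneralizedHeytingAlgebra h.Quo where
  le := Quotient.lift₂ (fun a b => D (imp a b)) fun a b c d hac hbd => propext
    ⟨fun hab => h.imp_trans hac.2 (h.imp_trans hab hbd.1),
      fun hcd => h.imp_trans hac.1 (h.imp_trans hcd hbd.2)⟩
  le_refl := h.ind h.imp_refl
  le_trans x y z := by
    induction x using h.ind; induction y using h.ind; induction z using h.ind
    exact h.imp_trans
  le_antisymm x y := by
    induction x using h.ind; induction y using h.ind
    exact fun h1 h2 => h.proj_eq.2 ⟨h1, h2⟩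
  sup := Quotient.map₂ join fun a b hab c d hcd =>
    ⟨h.join_imp (h.imp_trans hab.1 (h.join_left _ _)) (h.imp_trans hcd.1 (h.join_right _ _)),
      h.join_imp (h.imp_trans hab.2 (h.join_left _ _)) (h.imp_trans hcd.2 (h.join_right _ _))⟩
  le_sup_left x y := by
    induction x using h.ind; induction y using h.ind
    exact h.join_left _ _
  le_sup_right x y := by
    induction x using h.ind; induction y using h.ind
    exact h.join_right _ _
  sup_le x y z := by
    induction x using h.ind; induction y using h.ind; induction z using h.ind
    exact h.join_imp
  inf := Quotient.map₂ meet fun a b hab c d hcd =>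
    ⟨h.imp_meet (h.imp_trans (h.meet_left _ _) hab.1) (h.imp_trans (h.meet_right _ _) hcd.1),
      h.imp_meet (h.imp_trans (h.meet_left _ _) hab.2) (h.imp_trans (h.meet_right _ _) hcd.2)⟩
  inf_le_left x y := by
    induction x using h.ind; induction y using h.ind
    exact h.meet_left _ _
  inf_le_right x y := by
    induction x using h.ind; induction y using h.ind
    exact h.meet_right _ _
  le_inf x y z := by
    induction x using h.ind; induction y using h.ind; induction z using h.ind
    exact h.imp_meet
  top := h.proj (imp (Classical.arbitrary A) (Classical.arbitrary A))
  le_top := h.ind fun a => h.imp_const a (h.imp_refl _)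
  himp := Quotient.map₂ imp fun a b hab c d hcd => by
    have aux : ∀ {a b c d : A}, D (imp b a) → D (imp c d) → D (imp (imp a c) (imp b d)) :=
      fun hba hcd => h.imp_imp_iff.2 (h.imp_trans
        (h.imp_distrib (h.meet_left _ _) (h.imp_trans (h.meet_right _ _) hba)) hcd)
    exact ⟨aux hab.2 hcd.1, aux hab.1 hcd.2⟩
  le_himp_iff x y z := by
    induction x using h.ind; induction y using h.ind; induction z using h.ind
    exact h.imp_imp_iff

theorem proj_eq_top [Nonempty A] (h : IsFilter D) {a : A} : h.proj a = ⊤ ↔ D a := by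
  rw [← top_le_iff, ← himp_self (a := h.proj a)]
  exact ⟨fun ha => h.mp (h.imp_refl a) ha, fun ha => h.imp_const _ ha⟩

/-- The nucleus `[a] ↦ [∼∼a]` on the quotient by a filter. -/
noncomputable def box [Nonempty A] (h : IsFilter D) : Nucleus h.Quo where
  toFun := Quotient.map (fun a => neg (neg a)) fun _ _ hab =>
    ⟨h.neg_neg_mono hab.1, h.neg_neg_mono hab.2⟩
  map_inf' x y := by
    induction x using h.ind with | hP a
    induction y using h.ind with | hP b
    have key := h.ax _ (.ax14 (.var 0) (.var 1)) (assign a b a a)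
    exact h.proj_eq.2 ⟨h.mp key (h.meet_left _ _), h.mp key (h.meet_right _ _)⟩
  idempotent' := h.ind fun _ => h.neg_neg_neg_imp _
  le_apply' := h.ind h.imp_neg_neg

theorem twistRep [Nonempty A] (h : IsFilter D) : TwistRep h.box h.proj where
  map_meet _ _ := rfl
  map_join _ _ := rfl
  map_imp _ _ := rfl
  map_neg_neg _ := rfl
  neg_meet a b := by
    apply le_antisymm
    · -- The element `c` satisfies `∼a ⪯ ∼c` and `∼b ⪯ ∼c`, whence `∼(a ∧ b) ⪯ ∼(c ∧ c) ⪯ ∼c`.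
      let c := neg (join (neg a) (neg b))
      have hc : D (imp (join (neg a) (neg b)) (neg c)) := h.imp_neg_neg _
      have h1 : D (imp (neg (meet a b)) (neg (meet c c))) :=
        h.mp (h.imp_trans (h.join_right _ _) hc) (h.mp (h.imp_trans (h.join_left _ _) hc)
          (h.ax _ (.ax21 (.var 0) (.var 1) (.var 2) (.var 3)) (assign a c b c)))
      have h2 : D (imp (neg (meet c c)) (neg c)) :=
        h.mp (h.imp_refl _) (h.ax _ (.ax20 (.var 0) (.var 1)) (assign c c c c))
      exact h.imp_trans h1 h2
    · have h1 : ∀ a b : A, D (imp (neg a) (neg (meet a b))) := fun a b =>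
        h.ax _ (.ax18 (.var 0) (.var 1)) (assign a b a a)
      have h2 : D (imp (neg (meet b a)) (neg (meet a b))) :=
        h.ax _ (.ax19 (.var 0) (.var 1)) (assign b a a a)
      exact h.imp_trans (h.neg_neg_mono (h.join_imp (h1 a b) (h.imp_trans (h1 b a) h2)))
        (h.neg_neg_neg_imp _)
  neg_join a b := by
    have key := h.ax _ (.ax9 (.var 0) (.var 1)) (assign a b a a)
    exact h.proj_eq.2 ⟨h.mp key (h.meet_left _ _), h.mp key (h.meet_right _ _)⟩
  neg_imp a b := by
    have key := h.ax _ (.ax10 (.var 0) (.var 1)) (assign a b a a)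
    exact h.proj_eq.2 ⟨h.mp key (h.meet_left _ _), h.mp key (h.meet_right _ _)⟩
  box_neg a := h.proj_eq.2 ⟨h.neg_neg_neg_imp a, h.imp_neg_neg _⟩

end IsFilter

/-! ### The coincidence of the two classes -/

theorem IsAlgStar.isFilter {A : Type u} [AlgOps A] (h : IsAlgStar A) :
    IsFilter fun a : A => a = imp a a where
  ax φ hφ v := h.axioms_valid φ hφ v _ rfl
  mp {a b} h1 h2 := by
    refine h.modus_ponens (.var 0) (.var 1) (assign a b a a) ?_ ?_ _ rfl
    · rintro e rfl
      exact h1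
    · rintro e rfl
      exact h2

theorem IsAlgStar.faithful {A : Type u} [AlgOps A] (h : IsAlgStar A) :
    Faithful h.isFilter.proj := by
  intro a b hab hnab
  rw [IsFilter.proj_eq] at hab hnab
  refine h.separated (.var 0) (.var 1) (assign a b a a) ?_
  rintro e ⟨φ, rfl | rfl | rfl | rfl, rfl⟩
  exacts [hab.1, hab.2, hnab.1, hnab.2]

/-- The empty algebra is represented by the empty map to the one-element algebra. -/
theorem exists_twistRep_of_isEmpty (A : Type u) [AlgOps A] [IsEmpty A] :
    ∃ (j : Nucleus PUnit.{1}) (q : A → PUnit), TwistRep j q ∧ Faithful q :=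
  ⟨⊥, fun _ => PUnit.unit,
    ⟨isEmptyElim, isEmptyElim, isEmptyElim, isEmptyElim, isEmptyElim, isEmptyElim, isEmptyElim,
      isEmptyElim⟩, isEmptyElim⟩

theorem isQN4Lattice_iff_isAlgStar (A : Type u) [AlgOps A] : IsQN4Lattice A ↔ IsAlgStar A := by
  rcases isEmpty_or_nonempty A with hA | hA
  · obtain ⟨j, q, h, hq⟩ := exists_twistRep_of_isEmpty A
    exact iff_of_true (h.isQN4Lattice hq) (h.isAlgStar hq)
  · refine ⟨fun hA => ?_, fun hA => hA.isFilter.twistRep.isQN4Lattice hA.faithful⟩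
    obtain ⟨H, _, j, q, h, hq⟩ := hA.twistRep
    exact h.isAlgStar hq

/-! ### Full twist algebras and completeness -/

/-- The pairs over a generalized Heyting algebra whose second component is fixed by the
nucleus `j`. -/
def Twist {H : Type u} [GeneralizedHeytingAlgebra H] (j : Nucleus H) : Type u :=
  {p : H × H // j p.2 = p.2}

namespace Twist

variable {H : Type u} [GeneralizedHeytingAlgebra H] {j : Nucleus H}

instance : AlgOps (Twist j) where
  meet x y := ⟨(x.1.1 ⊓ y.1.1, j (x.1.2 ⊔ y.1.2)), j.idempotent _⟩
  join x y := ⟨(x.1.1 ⊔ y.1.1, x.1.2 ⊓ y.1.2), by simp only [j.map_inf, x.2, y.2]⟩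
  imp x y := ⟨(x.1.1 ⇨ y.1.1, j (x.1.1 ⊓ y.1.2)), j.idempotent _⟩
  neg x := ⟨(x.1.2, j x.1.1), j.idempotent _⟩

theorem twistRep (j : Nucleus H) : TwistRep j fun x : Twist j => x.1.1 where
  map_meet _ _ := rfl
  map_join _ _ := rfl
  map_imp _ _ := rfl
  map_neg_neg _ := rfl
  neg_meet _ _ := rfl
  neg_join _ _ := rfl
  neg_imp _ _ := rfl
  box_neg x := x.2

theorem faithful (j : Nucleus H) : Faithful fun x : Twist j => x.1.1 :=
  fun _ _ h1 h2 => Subtype.ext (Prod.ext h1 h2)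

end Twist

/-- The pair representing an element, as an element of the full twist algebra. -/
def TwistRep.toTwist {A : Type*} {H : Type u} [AlgOps A] [GeneralizedHeytingAlgebra H]
    {j : Nucleus H} {q : A → H} (h : TwistRep j q) (a : A) : Twist j :=
  ⟨(q a, q (neg a)), h.box_neg a⟩

theorem TwistRep.eval_toTwist {A : Type v} {H : Type u} [AlgOps A] [GeneralizedHeytingAlgebra H]
    {j : Nucleus H} {q : A → H} (h : TwistRep j q) (v : ℕ → A) (φ : Fm) :
    φ.eval (fun n => h.toTwist (v n)) = h.toTwist (φ.eval v) := by
  induction φ with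
  | var n => rfl
  | neg α ihα =>
    rw [Fm.eval, ihα]
    exact Subtype.ext (Prod.ext rfl (h.map_neg_neg _).symm)
  | and α β ihα ihβ =>
    rw [Fm.eval, ihα, ihβ]
    exact Subtype.ext (Prod.ext (h.map_meet _ _).symm (h.neg_meet _ _).symm)
  | or α β ihα ihβ =>
    rw [Fm.eval, ihα, ihβ]
    exact Subtype.ext (Prod.ext (h.map_join _ _).symm (h.neg_join _ _).symm)
  | imp α β ihα ihβ =>
    rw [Fm.eval, ihα, ihβ]
    exact Subtype.ext (Prod.ext (h.map_imp _ _).symm (h.neg_imp _ _).symm)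

/-- The formula algebra, lifted to the universe of the algebras under consideration. -/
instance : AlgOps (ULift.{u} Fm) where
  meet α β := ⟨.and α.down β.down⟩
  join α β := ⟨.or α.down β.down⟩
  imp α β := ⟨.imp α.down β.down⟩
  neg α := ⟨.neg α.down⟩

theorem eval_up_var (φ : Fm) : φ.eval (fun n => ULift.up.{u} (Fm.var n)) = ULift.up φ := by
  induction φ with
  | var n => rfl
  | neg α ihα => rw [Fm.eval, ihα]; rfl
  | and α β ihα ihβ => rw [Fm.eval, ihα, ihβ]; rfl
  | or α β ihα ihβ => rw [Fm.eval, ihα, ihβ]; rfl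
  | imp α β ihα ihβ => rw [Fm.eval, ihα, ihβ]; rfl

/-- The axiom schemes are closed under substitution, which is evaluation in the formula algebra. -/
theorem IsAxiom.eval_down {φ : Fm} (hφ : IsAxiom φ) (v : ℕ → ULift.{u} Fm) :
    IsAxiom (φ.eval v).down := by
  cases hφ <;> constructor

theorem isFilter_derivable (Γ : Set Fm) :
    IsFilter fun φ : ULift.{u} Fm => Derivable Γ φ.down where
  ax _ hφ v := .ax (hφ.eval_down v)
  mp h1 h2 := .mp h1 h2

theorem Derivable.sound {Γ : Set Fm} {φ : Fm} (hφ : Derivable Γ φ) {A : Type u} [AlgOps A]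
    (hA : IsAlgStar A) (v : ℕ → A) (hv : ∀ t ∈ ESet E Γ, Sat v t) : ∀ e ∈ E φ, Sat v e := by
  induction hφ with
  | hyp h => exact fun e he => hv e ⟨_, h, he⟩
  | ax h => exact hA.axioms_valid _ h v
  | mp _ _ ih1 ih2 => exact hA.modus_ponens _ _ v ih1 ih2

theorem derivable_iff_eqCons (Γ : Set Fm) (φ : Fm) :
    Derivable Γ φ ↔
      ∀ e ∈ E φ, EqCons (fun (A : Type u) (_ : AlgOps A) => IsAlgStar A) (ESet E Γ) e := by
  refine ⟨fun h e he A _ hA v hv => h.sound hA v hv e he, fun h => ?_⟩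
  have hF := isFilter_derivable.{u} Γ
  have : Nonempty (ULift.{u} Fm) := ⟨⟨.var 0⟩⟩
  have hT := Twist.twistRep hF.box
  have hT' := Twist.faithful hF.box
  let v : ℕ → Twist hF.box := fun n => hF.twistRep.toTwist (ULift.up (Fm.var n))
  have key : ∀ ψ : Fm, Sat v (ψ, Fm.imp ψ ψ) ↔ Derivable Γ ψ := fun ψ => by
    refine (hT.eq_imp_self_iff hT').trans ?_
    have : ψ.eval v = hF.twistRep.toTwist (ULift.up ψ) := by
      rw [hF.twistRep.eval_toTwist, eval_up_var]
    rw [this]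
    exact hF.proj_eq_top
  refine (key φ).1 (h _ rfl (Twist hF.box) (hT.isAlgStar hT') v ?_)
  rintro t ⟨ψ, hψ, rfl⟩
  exact (key ψ).2 (.hyp hψ)

/-- Quasi-equations that axiomatize the `Alg*`-algebras. -/
def algStarQuasiEqns : Set (List Eqn × Eqn) :=
  {p | ∃ φ, IsAxiom φ ∧ p = ([], (φ, Fm.imp φ φ))} ∪
  {p | ∃ α, ∃ e ∈ ESet E (Δ α α), p = ([], e)} ∪
  {p | ∃ α β, p =
    ([Fm.imp α β, Fm.imp β α, Fm.imp α.neg β.neg, Fm.imp β.neg α.neg].map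
      fun φ => (φ, Fm.imp φ φ), (α, β))} ∪
  {p | ∃ α β, p =
    ([α, Fm.imp α β].map fun φ => (φ, Fm.imp φ φ), (β, Fm.imp β β))}

theorem isQuasivariety_isAlgStar :
    IsQuasivariety fun (A : Type u) (_ : AlgOps A) => IsAlgStar A := by
  refine ⟨algStarQuasiEqns, fun A _ => ⟨?_, fun h => ⟨?_, ?_, ?_, ?_⟩⟩⟩
  · rintro hA q (((⟨φ, hφ, rfl⟩ | ⟨α, e, he, rfl⟩) | ⟨α, β, rfl⟩) | ⟨α, β, rfl⟩) v hv
    · exact hA.axioms_valid φ hφ v _ rfl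
    · exact hA.refl_valid α v e he
    · refine hA.separated α β v ?_
      rintro e ⟨φ, hφ, rfl⟩
      refine hv _ (List.mem_map_of_mem ?_)
      rcases hφ with rfl | rfl | rfl | rfl <;> simp
    · refine hA.modus_ponens α β v ?_ ?_ _ rfl <;> rintro e rfl <;> exact hv _ (by simp)
  · rintro φ hφ v e rfl
    exact h _ (.inl (.inl (.inl ⟨φ, hφ, rfl⟩))) v (by simp)
  · intro α v e he
    exact h _ (.inl (.inl (.inr ⟨α, e, he, rfl⟩))) v (by simp)
  · intro α β v hv
    refine h _ (.inl (.inr ⟨α, β, rfl⟩)) v fun t ht => ?_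
    obtain ⟨φ, hφ, rfl⟩ := List.mem_map.1 ht
    exact hv _ ⟨φ, by simpa [Δ] using hφ, rfl⟩
  · rintro α β v h1 h2 e rfl
    refine h _ (.inr ⟨α, β, rfl⟩) v fun t ht => ?_
    simp only [List.map_cons, List.map_nil, List.mem_cons, List.not_mem_nil, or_false] at ht
    rcases ht with rfl | rfl
    exacts [h1 _ rfl, h2 _ rfl]

theorem isEquivAlgSemantics_isAlgStar :
    IsEquivAlgSemantics Derivable E Δ (fun (A : Type u) (_ : AlgOps A) => IsAlgStar A) where
  quasivariety := isQuasivariety_isAlgStar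
  complete := derivable_iff_eqCons
  eq_to α β e he A _ hA v hv := by
    have hαβ : α.eval v = β.eval v := hv _ rfl
    have refl : ∀ x : A, imp x x = imp (imp x x) (imp x x) := fun x =>
      hA.refl_valid (.var 0) (fun _ => x) _ ⟨_, .inl rfl, rfl⟩
    obtain ⟨φ, hφ, rfl⟩ := he
    rcases hφ with rfl | rfl | rfl | rfl <;> simp only [Sat, Fm.eval, hαβ] <;> exact refl _
  to_eq α β A _ hA v hv := hA.separated α β v hv

end QN4

theorem mainTheorem1 :
    (∀ (A : Type u) [QN4.AlgOps A], QN4.IsQN4Lattice A ↔ QN4.IsAlgStar A) ∧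
    QN4.IsEquivAlgSemantics QN4.Derivable QN4.E QN4.Δ
      (fun (A : Type u) (_ : QN4.AlgOps A) => QN4.IsAlgStar A) :=
  ⟨fun A _ => QN4.isQN4Lattice_iff_isAlgStar A, QN4.isEquivAlgSemantics_isAlgStar⟩
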